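/- **Closure of the differential.** Let $(X,\mathsf d)$ be a complete and separable metric space, let $m\neq 0$ be a non-negative Borel measure on $X$ that is finite on balls, and let $p\in(1,\infty)$. Functions are considered up to $m$-a.e. equality. $L^0(m)^+$ denotes the Borel functions $X\to[0,+\infty]$; $L^p_{loc}(m)$ denotes the Borel functions $u:X\to\mathbb R$ with $u|_B\in L^p(m|_B)$ for every bounded Borel set $B$, and $u_n\to u$ in $L^p_{loc}(m)$ means that $u_n\to u$ in $L^p(m|_B)$ for every bounded Borel set $B$. $\mathrm{Lip}$ denotes the (best) Lipschitz constant. A *$D$-structure* is a map $D$ that associates to each $u\in L^p_{loc}(m)$ a set $D[u]\subseteq L^0(m)^+$ such that: * (A1) $\mathrm{Lip}(u)\,\chi_{\{u>0\}}\in D[u]$ for every non-negative Lipschitz $u\in L^p_{loc}(m)$; * (A2) if $g_1\in D[u_1]$, $g_2\in D[u_2]$, $\alpha_1,\alpha_2\in\mathbb R$ and $g\in L^0(m)^+$ satisfies $g\ge|\alpha_1|g_1+|\alpha_2|g_2$ $m$-a.e., then $g\in D[\alpha_1u_1+\alpha_2u_2]$; * (A3) if $g\in D[u]$ and $\varphi:X\to\mathbb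 R$ is bounded and Lipschitz, then $g\sup_X|\varphi|+\mathrm{Lip}(\varphi)|u|\in D[\varphi u]$; * (A4) if $g_1\in D[u_1]$ and $g_2\in D[u_2]$, then $\max\{g_1,g_2\}\in D[\max\{u_1,u_2\}]\cap D[\min\{u_1,u_2\}]$; * (A5) if $g_n\in D[u_n]\cap L^p(m)$ for all $n$, $u_n\to u$ in $L^p_{loc}(m)$ and $g_n\to g$ in $L^p(m)$, where $u\in L^p_{loc}(m)$ and $g\in L^p(m)$ is non-negative, then $g\in D[u]$. For a Borel set $B$ let $\mathcal E_p(u|B)=\inf\{\int_B g^p\,dm: g\in D[u]\}\in[0,+\infty]$, and let $\mathrm S^p(X)=\{u\in L^p_{loc}(m):\mathcal E_p(u|X)<+\infty\}$, which is a vector space. For $u\in\mathrm S^p(X)$, the *minimal pseudo-gradient* $\underline Du$ is the unique element of $D[u]$ with $\int_X(\underline Du)^p\,dm=\mathcal E_p(u|X)$. The $D$-structure is *pointwise local* if (L1) $\mathcal E_p(u|B)=0$ whenever $u\in\mathrm S^p(X)$ is $m$-a.e. constant on the Borel set $B$, and (L5) $\underline Du\le g$ $m$-a.e. whenever $u\in\mathrm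 S^p(X)$ and $g\in D[u]$. Let $D$ be a pointwise local $D$-structure. The *cotangent module* $L^p(T^*X;D)$ is the Banach space obtained as the Hausdorff completion of the vector space of finite families $[B_i,u_i]_i$, where $(B_i)_i$ is a finite Borel partition of $X$ and $u_i\in\mathrm S^p(X)$, with operations $[B_i,u_i]_i+[C_j,v_j]_j=[B_i\cap C_j,u_i+v_j]_{i,j}$ and $\lambda[B_i,u_i]_i=[B_i,\lambda u_i]_i$, and seminorm $$\big\|[B_i,u_i]_i\big\|=\Big\|\sum_i\chi_{B_i}\underline Du_i\Big\|_{L^p(m)}=\Big(\sum_i\int_{B_i}(\underline Du_i)^p\,dm\Big)^{1/p}.$$ The *differential* is the linear map $\mathrm d:\mathrm S^p(X)\to L^p(T^*X;D)$, $\mathrm du=[X,u]$. **Theorem.** The differential $\mathrm d$ is closed: if $(u_n)_n\subseteq\mathrm S^p(X)$ converges in $L^p_{loc}(m)$ to some $u\in L^p_{loc}(m)$, and $\mathrm du_n\rightharpoonup\omega$ weakly in $L^p(T^*X;D)$ for some $\omega\in L^p(T^*X;D)$, then $u\in\mathrm S^p(X)$ and $\mathrm du=\omega$. -/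

import Mathlib

open MeasureTheory Filter Topology Set
open scoped ENNReal NNReal

noncomputable section

/-- `L⁰(m)⁺`: Borel functions `X → [0,∞]` up to `m`-a.e. equality. -/
abbrev LZeroPlus {X : Type*} [MeasurableSpace X] (m : Measure X) := X →ₘ[m] ℝ≥0∞

/-- `L^p_loc(m)`: Borel functions `X → ℝ` up to `m`-a.e. equality whose restriction to every
bounded Borel set `B` belongs to `L^p(m|_B)`. -/
def Lploc {X : Type*} [MetricSpace X] [MeasurableSpace X] (m : Measure X) (p : ℝ) :
    Submodule ℝ (X →ₘ[m] ℝ) where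
  carrier := {u | ∀ B : Set X, MeasurableSet B → Bornology.IsBounded B →
    MemLp u (ENNReal.ofReal p) (m.restrict B)}
  zero_mem' := fun _ _ _ =>
    (memLp_congr_ae (ae_restrict_of_ae (AEEqFun.coeFn_zero (μ := m)))).2 MemLp.zero'
  add_mem' := fun {u v} hu hv B hB hb =>
    (memLp_congr_ae (ae_restrict_of_ae (AEEqFun.coeFn_add u v))).2
      ((hu B hB hb).add (hv B hB hb))
  smul_mem' := fun c u hu B hB hb =>
    (memLp_congr_ae (ae_restrict_of_ae (AEEqFun.coeFn_smul c u))).2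
      ((hu B hB hb).const_smul c)

/-- Convergence of a sequence in `L^p_loc(m)`: convergence in `L^p(m|_B)` for every bounded Borel
set `B`. -/
def TendstoLploc {X : Type*} [MetricSpace X] [MeasurableSpace X] {m : Measure X} {p : ℝ}
    (u : ℕ → Lploc m p) (v : Lploc m p) : Prop :=
  ∀ B : Set X, MeasurableSet B → Bornology.IsBounded B →
    Tendsto (fun n => eLpNorm (fun x => (u n : X →ₘ[m] ℝ) x - (v : X →ₘ[m] ℝ) x)
      (ENNReal.ofReal p) (m.restrict B)) atTop (𝓝 0)

/-- The (best) Lipschitz constant of a Lipschitz function. -/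
def lipConst {X : Type*} [MetricSpace X] (f : X → ℝ) : ℝ≥0 := sInf {K : ℝ≥0 | LipschitzWith K f}

/-- A `D`-structure on `(X, d, m)` with exponent `p ∈ [1,∞)`: to each `u ∈ L^p_loc(m)` it
associates a set `pg u ⊆ L⁰(m)⁺` of pseudo-gradients, subject to the axioms A1-A5 of
Gol'dshtein and Troyanov. -/
structure DStructure {X : Type*} [MetricSpace X] [MeasurableSpace X] (m : Measure X) (p : ℝ) where
  one_le_p : 1 ≤ p
  pg : Lploc m p → Set (LZeroPlus m)
  /-- A1: `Lip(u) χ_{u > 0} ∈ D[u]` for every nonnegative Lipschitz `u ∈ L^p_loc(m)`. -/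
  nontriviality : ∀ (u : Lploc m p) (f : X → ℝ) (g : LZeroPlus m),
    (∃ K : ℝ≥0, LipschitzWith K f) → (∀ x, 0 ≤ f x) → (u : X →ₘ[m] ℝ) =ᵐ[m] f →
    g =ᵐ[m] {x | 0 < f x}.indicator (fun _ => (lipConst f : ℝ≥0∞)) → g ∈ pg u
  /-- A2. -/
  upper_linearity : ∀ (u₁ u₂ : Lploc m p) (g₁ g₂ g : LZeroPlus m) (α₁ α₂ : ℝ),
    g₁ ∈ pg u₁ → g₂ ∈ pg u₂ → (∀ᵐ x ∂m, ‖α₁‖ₑ * g₁ x + ‖α₂‖ₑ * g₂ x ≤ g x) →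
    g ∈ pg (α₁ • u₁ + α₂ • u₂)
  /-- A3: `g sup|φ| + Lip(φ)|u| ∈ D[φu]` for `g ∈ D[u]` and `φ` bounded Lipschitz. -/
  leibniz : ∀ (u w : Lploc m p) (g h : LZeroPlus m) (φ : X → ℝ),
    g ∈ pg u → (∃ K : ℝ≥0, LipschitzWith K φ) → (∃ C : ℝ, ∀ x, |φ x| ≤ C) →
    (w : X →ₘ[m] ℝ) =ᵐ[m] (fun x => φ x * (u : X →ₘ[m] ℝ) x) →
    h =ᵐ[m] (fun x => g x * (⨆ y, ‖φ y‖ₑ) + (lipConst φ : ℝ≥0∞) * ‖(u : X →ₘ[m] ℝ) x‖ₑ) →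
    h ∈ pg w
  /-- A4, maximum. -/
  lattice_max : ∀ (u₁ u₂ w : Lploc m p) (g₁ g₂ : LZeroPlus m), g₁ ∈ pg u₁ → g₂ ∈ pg u₂ →
    (w : X →ₘ[m] ℝ) = (u₁ : X →ₘ[m] ℝ) ⊔ (u₂ : X →ₘ[m] ℝ) → g₁ ⊔ g₂ ∈ pg w
  /-- A4, minimum. -/
  lattice_min : ∀ (u₁ u₂ w : Lploc m p) (g₁ g₂ : LZeroPlus m), g₁ ∈ pg u₁ → g₂ ∈ pg u₂ →
    (w : X →ₘ[m] ℝ) = (u₁ : X →ₘ[m] ℝ) ⊓ (u₂ : X →ₘ[m] ℝ) → g₁ ⊔ g₂ ∈ pg w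
  /-- A5: if `gₙ ∈ D[uₙ] ∩ L^p(m)`, `uₙ → u` in `L^p_loc(m)` and `gₙ → g` in `L^p(m)`, then
  `g ∈ D[u]`. (Elements of `L^p(m)⁺` are a.e. finite, so `toReal` loses nothing.) -/
  completeness : ∀ (u : ℕ → Lploc m p) (v : Lploc m p) (g : ℕ → LZeroPlus m) (h : LZeroPlus m),
    (∀ n, g n ∈ pg (u n)) → (∀ n, ∫⁻ x, g n x ^ p ∂m < ∞) → ∫⁻ x, h x ^ p ∂m < ∞ →
    TendstoLploc u v →
    Tendsto (fun n => eLpNorm (fun x => (g n x).toReal - (h x).toReal) (ENNReal.ofReal p) m)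
      atTop (𝓝 0) →
    h ∈ pg v

namespace DStructure

variable {X : Type*} [MetricSpace X] [MeasurableSpace X] {m : Measure X} {p : ℝ}

/-- The `p`-Dirichlet energy of `u` on `B`. -/
def energy (D : DStructure m p) (u : Lploc m p) (B : Set X) : ℝ≥0∞ :=
  ⨅ g ∈ D.pg u, ∫⁻ x in B, g x ^ p ∂m

theorem p_pos (D : DStructure m p) : 0 < p := lt_of_lt_of_le one_pos D.one_le_p

theorem energy_lt_top_iff (D : DStructure m p) (u : Lploc m p) :
    D.energy u univ < ∞ ↔ ∃ g ∈ D.pg u, ∫⁻ x, g x ^ p ∂m < ∞ := by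
  simp [energy, iInf_lt_iff]

theorem zero_mem_pg (D : DStructure m p) : (0 : LZeroPlus m) ∈ D.pg 0 := by
  refine D.nontriviality 0 (fun _ => 0) 0 ⟨0, LipschitzWith.const 0⟩ (fun _ => le_rfl)
    AEEqFun.coeFn_zero ?_
  refine AEEqFun.coeFn_zero.trans (Eventually.of_forall fun x => ?_)
  simp

theorem add_mem_pg (D : DStructure m p) {u v : Lploc m p} {g h : LZeroPlus m}
    (hg : g ∈ D.pg u) (hh : h ∈ D.pg v) : g + h ∈ D.pg (u + v) := by
  have := D.upper_linearity u v g h (g + h) 1 1 hg hh (by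
    filter_upwards [AEEqFun.coeFn_add g h] with x hx
    simp [hx])
  simpa using this

theorem exists_smul_mem_pg (D : DStructure m p) {u : Lploc m p} {g : LZeroPlus m}
    (hg : g ∈ D.pg u) (c : ℝ) :
    ∃ h ∈ D.pg (c • u), h =ᵐ[m] fun x => ‖c‖ₑ * g x := by
  have hm : AEStronglyMeasurable (fun x => ‖c‖ₑ * g x) m :=
    (g.measurable.const_mul _).aestronglyMeasurable
  refine ⟨AEEqFun.mk _ hm, ?_, AEEqFun.coeFn_mk _ hm⟩
  have := D.upper_linearity u 0 g 0 (AEEqFun.mk _ hm) c 0 hg D.zero_mem_pg (by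
    filter_upwards [AEEqFun.coeFn_mk _ hm] with x hx
    simp [hx])
  simpa using this

theorem lintegral_add_rpow_lt_top (D : DStructure m p) {f g : X → ℝ≥0∞} (hf : Measurable f)
    (hf' : ∫⁻ x, f x ^ p ∂m < ∞) (hg' : ∫⁻ x, g x ^ p ∂m < ∞) :
    ∫⁻ x, (f x + g x) ^ p ∂m < ∞ := by
  calc ∫⁻ x, (f x + g x) ^ p ∂m
      ≤ ∫⁻ x, 2 ^ (p - 1) * (f x ^ p + g x ^ p) ∂m :=
        lintegral_mono fun x => ENNReal.rpow_add_le_mul_rpow_add_rpow _ _ D.one_le_p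
    _ = 2 ^ (p - 1) * (∫⁻ x, f x ^ p ∂m + ∫⁻ x, g x ^ p ∂m) := by
        rw [lintegral_const_mul' _ _ (by
          exact ENNReal.rpow_ne_top_of_nonneg (by linarith [D.one_le_p]) (by simp)),
          lintegral_add_left (hf.pow_const p)]
    _ < ∞ := ENNReal.mul_lt_top
        (ENNReal.rpow_lt_top_of_nonneg (by linarith [D.one_le_p]) (by simp))
        (ENNReal.add_lt_top.2 ⟨hf', hg'⟩)

/-- The Sobolev class `S^p(X) = {u ∈ L^p_loc(m) : E_p(u) < ∞}`. -/
def sobolevClass (D : DStructure m p) : Submodule ℝ (Lploc m p) where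
  carrier := {u | D.energy u univ < ∞}
  zero_mem' := by
    refine (D.energy_lt_top_iff 0).2 ⟨0, D.zero_mem_pg, ?_⟩
    rw [lintegral_congr_ae (g := fun _ => 0)]
    · simp
    · filter_upwards [AEEqFun.coeFn_zero (μ := m) (β := ℝ≥0∞)] with x hx
      simp [hx, D.p_pos]
  add_mem' := fun {u v} hu hv => by
    obtain ⟨g, hg, hg'⟩ := (D.energy_lt_top_iff u).1 hu
    obtain ⟨h, hh, hh'⟩ := (D.energy_lt_top_iff v).1 hv
    refine (D.energy_lt_top_iff _).2 ⟨g + h, D.add_mem_pg hg hh, ?_⟩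
    rw [lintegral_congr_ae (g := fun x => (g x + h x) ^ p)]
    · exact D.lintegral_add_rpow_lt_top g.measurable hg' hh'
    · filter_upwards [AEEqFun.coeFn_add g h] with x hx
      simp [hx]
  smul_mem' := fun c u hu => by
    obtain ⟨g, hg, hg'⟩ := (D.energy_lt_top_iff u).1 hu
    obtain ⟨h, hh, hh'⟩ := D.exists_smul_mem_pg hg c
    refine (D.energy_lt_top_iff _).2 ⟨h, hh, ?_⟩
    have hc : ‖c‖ₑ ^ p < ∞ := ENNReal.rpow_lt_top_of_nonneg D.p_pos.le (by simp)
    rw [lintegral_congr_ae (g := fun x => ‖c‖ₑ ^ p * g x ^ p), lintegral_const_mul' _ _ hc.ne]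
    · exact ENNReal.mul_lt_top hc hg'
    · filter_upwards [hh'] with x hx
      simp [hx, ENNReal.mul_rpow_of_nonneg _ _ D.p_pos.le]

/-- `g` is a minimal pseudo-gradient of `u`: it belongs to `D[u]` and attains the energy. -/
def IsMinimal (D : DStructure m p) (u : Lploc m p) (g : LZeroPlus m) : Prop :=
  g ∈ D.pg u ∧ ∫⁻ x, g x ^ p ∂m = D.energy u univ

/-- The minimal pseudo-gradient `Du` of `u ∈ S^p(X)` (see `isMinimal_minPG` for existence and
`IsMinimal.unique` for uniqueness, when `p > 1`). -/
def minPG (D : DStructure m p) (u : D.sobolevClass) : LZeroPlus m :=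
  Classical.epsilon (D.IsMinimal u)

/- Existence and uniqueness of the minimal pseudo-gradient. -/

theorem midpoint_rpow_lt {t : ℝ} (hp : 1 < p) (ht : 0 ≤ t) (ht1 : t < 1) :
    ((1 + t) / 2) ^ p < (1 + t ^ p) / 2 := by
  have := (strictConvexOn_rpow hp).2 (show (1 : ℝ) ∈ Ici 0 by simp) (show t ∈ Ici 0 from ht)
    ht1.ne' (show (0 : ℝ) < 1 / 2 by norm_num) (show (0 : ℝ) < 1 / 2 by norm_num) (by norm_num)
  simp only [smul_eq_mul, Real.one_rpow] at this
  calc ((1 + t) / 2) ^ p = (1 / 2 * 1 + 1 / 2 * t) ^ p := by congr 1; ring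
    _ < _ := this
    _ = _ := by ring

theorem exists_uniform_convexity_unit (hp : 1 < p) {ε : ℝ} (hε : 0 < ε) :
    ∃ C : ℝ, 0 < C ∧ ∀ t : ℝ, 0 ≤ t → t ≤ 1 →
      (1 - t) ^ p + C * ((1 + t) / 2) ^ p ≤ ε * (1 + t ^ p) + C * ((1 + t ^ p) / 2) := by
  have hp0 : 0 < p := by linarith
  obtain ⟨δ, hδ, hδ1, hδε⟩ : ∃ δ : ℝ, 0 < δ ∧ δ ≤ 1 ∧ δ ^ p ≤ ε := by
    refine ⟨min 1 (ε ^ (1 / p)), lt_min one_pos (Real.rpow_pos_of_pos hε _), min_le_left _ _, ?_⟩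
    calc (min 1 (ε ^ (1 / p))) ^ p ≤ (ε ^ (1 / p)) ^ p :=
          Real.rpow_le_rpow (le_min zero_le_one (by positivity)) (min_le_right _ _) hp0.le
      _ = ε := by rw [← Real.rpow_mul hε.le]; field_simp; simp
  have hcont : Continuous fun t : ℝ => (1 + t ^ p) / 2 - ((1 + t) / 2) ^ p := by
    have h1 : Continuous fun t : ℝ => t ^ p := Real.continuous_rpow_const hp0.le
    have h2 : Continuous fun t : ℝ => ((1 + t) / 2) ^ p := h1.comp (by fun_prop)
    exact ((continuous_const.add h1).div_const 2).sub h2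
  obtain ⟨t₀, ht₀, hmin⟩ := (isCompact_Icc (a := (0 : ℝ)) (b := 1 - δ)).exists_isMinOn
    ⟨0, by simp [hδ1]⟩ hcont.continuousOn
  set c := (1 + t₀ ^ p) / 2 - ((1 + t₀) / 2) ^ p with hc
  have hcpos : 0 < c := by
    have := midpoint_rpow_lt hp ht₀.1 (by linarith [ht₀.2] : t₀ < 1)
    rw [hc]; linarith
  refine ⟨1 / c, by positivity, fun t ht ht1 => ?_⟩
  have htp : 0 ≤ t ^ p := Real.rpow_nonneg ht p
  rcases le_or_gt t (1 - δ) with h | h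
  · have h1 : c ≤ (1 + t ^ p) / 2 - ((1 + t) / 2) ^ p := hmin ⟨ht, h⟩
    have h2 : (1 - t) ^ p ≤ 1 := Real.rpow_le_one (by linarith) (by linarith) hp0.le
    have h3 : 1 ≤ 1 / c * ((1 + t ^ p) / 2 - ((1 + t) / 2) ^ p) := by
      rw [one_div, ← div_eq_inv_mul, le_div_iff₀ hcpos]; linarith
    have h4 : 0 ≤ ε * (1 + t ^ p) := by positivity
    linarith [mul_sub (1 / c) ((1 + t ^ p) / 2) (((1 + t) / 2) ^ p)]
  · have h1 : (1 - t) ^ p ≤ ε :=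
      (Real.rpow_le_rpow (by linarith) (by linarith) hp0.le).trans hδε
    have h2 : ((1 + t) / 2) ^ p ≤ (1 + t ^ p) / 2 := by
      rcases ht1.lt_or_eq with h3 | h3
      · exact (midpoint_rpow_lt hp ht h3).le
      · simp [h3]
    have h3 : 1 / c * ((1 + t) / 2) ^ p ≤ 1 / c * ((1 + t ^ p) / 2) :=
      mul_le_mul_of_nonneg_left h2 (by positivity)
    have h4 : 0 ≤ ε * t ^ p := by positivity
    linarith

theorem exists_uniform_convexity (hp : 1 < p) {ε : ℝ} (hε : 0 < ε) :
    ∃ C : ℝ, 0 < C ∧ ∀ a b : ℝ, 0 ≤ a → 0 ≤ b →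
      |a - b| ^ p + C * ((a + b) / 2) ^ p ≤ ε * (a ^ p + b ^ p) + C * ((a ^ p + b ^ p) / 2) := by
  obtain ⟨C, hC, h⟩ := exists_uniform_convexity_unit hp hε
  have hp0 : p ≠ 0 := by linarith
  have key : ∀ a b : ℝ, 0 ≤ b → b ≤ a →
      |a - b| ^ p + C * ((a + b) / 2) ^ p ≤ ε * (a ^ p + b ^ p) + C * ((a ^ p + b ^ p) / 2) := by
    intro a b hb hba
    rcases (hb.trans hba).eq_or_lt with ha | ha
    · have hb0 : b = 0 := by linarith
      subst hb0; subst ha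
      simp [Real.zero_rpow hp0]
    · have h1 := h (b / a) (by positivity) ((div_le_one ha).2 hba)
      have e1 : |a - b| ^ p = a ^ p * (1 - b / a) ^ p := by
        rw [← Real.mul_rpow ha.le (by linarith [(div_le_one ha).2 hba]),
          abs_of_nonneg (by linarith)]
        congr 1; field_simp
      have e2 : ((a + b) / 2) ^ p = a ^ p * ((1 + b / a) / 2) ^ p := by
        rw [← Real.mul_rpow ha.le (by positivity)]
        congr 1; field_simp
      have e3 : b ^ p = a ^ p * (b / a) ^ p := by
        rw [← Real.mul_rpow ha.le (by positivity)]
        congr 1; field_simp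
      rw [e1, e2, e3]
      have := mul_le_mul_of_nonneg_left h1 (Real.rpow_nonneg ha.le p)
      linarith
  refine ⟨C, hC, fun a b ha hb => ?_⟩
  rcases le_total b a with hba | hab
  · exact key a b hb hba
  · have := key b a ha hab
    rw [abs_sub_comm, add_comm a b, add_comm (a ^ p)]
    exact this

theorem exists_midpoint_mem_pg (D : DStructure m p) {u : Lploc m p} {g h : LZeroPlus m}
    (hg : g ∈ D.pg u) (hh : h ∈ D.pg u) :
    ∃ k ∈ D.pg u, k =ᵐ[m] fun x => (g x + h x) / 2 := by
  have hm : AEStronglyMeasurable (fun x => (g x + h x) / 2) m :=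
    ((g.measurable.add h.measurable).div_const _).aestronglyMeasurable
  refine ⟨AEEqFun.mk _ hm, ?_, AEEqFun.coeFn_mk _ hm⟩
  have := D.upper_linearity u u g h (AEEqFun.mk _ hm) (1 / 2) (1 / 2) hg hh (by
    filter_upwards [AEEqFun.coeFn_mk _ hm] with x hx
    have h2 : ‖(1 / 2 : ℝ)‖ₑ = 2⁻¹ := by
      rw [Real.enorm_of_nonneg (by norm_num), one_div, ENNReal.ofReal_inv_of_pos (by norm_num)]
      simp
    rw [hx, h2, ENNReal.div_eq_inv_mul, mul_add])
  rwa [← add_smul, show (1 / 2 + 1 / 2 : ℝ) = 1 by norm_num, one_smul] at this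

theorem ae_lt_top_of_rpow (D : DStructure m p) {g : LZeroPlus m} (hg : ∫⁻ x, g x ^ p ∂m < ∞) :
    ∀ᵐ x ∂m, g x < ∞ := by
  filter_upwards [ae_lt_top (g.measurable.pow_const p) hg.ne] with x hx
  exact (ENNReal.rpow_lt_top_iff_of_pos D.p_pos).1 hx

theorem eLpNorm_toReal (D : DStructure m p) {g : LZeroPlus m} (hg : ∫⁻ x, g x ^ p ∂m < ∞) :
    eLpNorm (fun x => (g x).toReal) (ENNReal.ofReal p) m = (∫⁻ x, g x ^ p ∂m) ^ (1 / p) := by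
  rw [eLpNorm_eq_lintegral_rpow_enorm_toReal (by simp [D.p_pos]) (by simp),
    ENNReal.toReal_ofReal D.p_pos.le]
  congr 1
  refine lintegral_congr_ae ?_
  filter_upwards [D.ae_lt_top_of_rpow hg] with x hx
  rw [Real.enorm_of_nonneg ENNReal.toReal_nonneg, ENNReal.ofReal_toReal hx.ne]

theorem memLp_toReal (D : DStructure m p) {g : LZeroPlus m} (hg : ∫⁻ x, g x ^ p ∂m < ∞) :
    MemLp (fun x => (g x).toReal) (ENNReal.ofReal p) m := by
  refine ⟨g.measurable.ennreal_toReal.aestronglyMeasurable, ?_⟩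
  rw [D.eLpNorm_toReal hg]
  exact ENNReal.rpow_lt_top_of_nonneg (by have := D.p_pos; positivity) hg.ne

/-- Quantitative uniform convexity for two pseudo-gradients of the same function. -/
theorem lintegral_sub_rpow_le (D : DStructure m p) (u : D.sobolevClass) {ε C : ℝ}
    (hε : 0 ≤ ε) (hC : 0 ≤ C)
    (h : ∀ a b : ℝ, 0 ≤ a → 0 ≤ b →
      |a - b| ^ p + C * ((a + b) / 2) ^ p ≤ ε * (a ^ p + b ^ p) + C * ((a ^ p + b ^ p) / 2))
    {g k : LZeroPlus m} (hg : g ∈ D.pg u) (hk : k ∈ D.pg u)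
    (hg' : ∫⁻ x, g x ^ p ∂m < ∞) (hk' : ∫⁻ x, k x ^ p ∂m < ∞) :
    ∫⁻ x, ‖(g x).toReal - (k x).toReal‖ₑ ^ p ∂m + ENNReal.ofReal C * D.energy u univ ≤
      ENNReal.ofReal (ε + C / 2) * (∫⁻ x, g x ^ p ∂m + ∫⁻ x, k x ^ p ∂m) := by
  obtain ⟨j, hj, hj'⟩ := D.exists_midpoint_mem_pg hg hk
  have hE : D.energy u univ ≤ ∫⁻ x, j x ^ p ∂m := by
    simpa [energy] using iInf₂_le (f := fun g (_ : g ∈ D.pg u) => ∫⁻ x in univ, g x ^ p ∂m) j hj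
  calc _ ≤ ∫⁻ x, ‖(g x).toReal - (k x).toReal‖ₑ ^ p ∂m
          + ENNReal.ofReal C * ∫⁻ x, j x ^ p ∂m := by gcongr
    _ = ∫⁻ x, (‖(g x).toReal - (k x).toReal‖ₑ ^ p + ENNReal.ofReal C * j x ^ p) ∂m := by
        rw [lintegral_add_right _ ((j.measurable.pow_const p).const_mul _),
          lintegral_const_mul _ (j.measurable.pow_const p)]
    _ ≤ ∫⁻ x, ENNReal.ofReal (ε + C / 2) * (g x ^ p + k x ^ p) ∂m := by
        refine lintegral_mono_ae ?_
        filter_upwards [hj', D.ae_lt_top_of_rpow hg', D.ae_lt_top_of_rpow hk'] with x hx h1 h2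
        obtain ⟨a, ha⟩ : ∃ a : ℝ, 0 ≤ a ∧ g x = ENNReal.ofReal a :=
          ⟨(g x).toReal, ENNReal.toReal_nonneg, (ENNReal.ofReal_toReal h1.ne).symm⟩
        obtain ⟨b, hb⟩ : ∃ b : ℝ, 0 ≤ b ∧ k x = ENNReal.ofReal b :=
          ⟨(k x).toReal, ENNReal.toReal_nonneg, (ENNReal.ofReal_toReal h2.ne).symm⟩
        have e : j x = ENNReal.ofReal ((a + b) / 2) := by
          rw [hx, ha.2, hb.2, ← ENNReal.ofReal_add ha.1 hb.1,
            ENNReal.ofReal_div_of_pos (by norm_num)]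
          simp
        have hp0 := D.p_pos.le
        have ha1 := ha.1
        have hb1 := hb.1
        rw [e, ha.2, hb.2, ENNReal.toReal_ofReal ha1, ENNReal.toReal_ofReal hb1,
          Real.enorm_eq_ofReal_abs, ENNReal.ofReal_rpow_of_nonneg (abs_nonneg _) hp0,
          ENNReal.ofReal_rpow_of_nonneg (by positivity) hp0,
          ENNReal.ofReal_rpow_of_nonneg ha1 hp0, ENNReal.ofReal_rpow_of_nonneg hb1 hp0,
          ← ENNReal.ofReal_mul hC, ← ENNReal.ofReal_add (by positivity) (by positivity),
          ← ENNReal.ofReal_add (by positivity) (by positivity),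
          ← ENNReal.ofReal_mul (by positivity)]
        refine ENNReal.ofReal_le_ofReal ?_
        have := h a b ha1 hb1
        linarith
    _ = _ := by
        rw [lintegral_const_mul' _ _ ENNReal.ofReal_ne_top,
          lintegral_add_left (g.measurable.pow_const p)]

/-- Minimal pseudo-gradients exist. -/
theorem exists_isMinimal (D : DStructure m p) (hp : 1 < p) (u : D.sobolevClass) :
    ∃ g, D.IsMinimal u g := by
  have hE : D.energy u univ < ∞ := u.2
  set E := D.energy u univ with hEdef
  have hmem : ∀ n : ℕ, ∃ g ∈ D.pg u, ∫⁻ x, g x ^ p ∂m < E + ((n : ℝ≥0∞) + 1)⁻¹ := by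
    intro n
    have : E < E + ((n : ℝ≥0∞) + 1)⁻¹ := ENNReal.lt_add_right hE.ne (by simp)
    rw [hEdef] at this
    nth_rewrite 1 [energy] at this
    simpa [iInf_lt_iff] using this
  choose g hg hgE using hmem
  have hfin : ∀ n, ∫⁻ x, g n x ^ p ∂m < ∞ := fun n =>
    (hgE n).trans_le (le_top)
  have hEle : ∀ n, E ≤ ∫⁻ x, g n x ^ p ∂m := fun n => by
    simpa [hEdef, energy] using
      iInf₂_le (f := fun g (_ : g ∈ D.pg u) => ∫⁻ x in univ, g x ^ p ∂m) (g n) (hg n)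
  have hlim : Tendsto (fun n => ∫⁻ x, g n x ^ p ∂m) atTop (𝓝 E) := by
    refine tendsto_of_tendsto_of_tendsto_of_le_of_le tendsto_const_nhds ?_ hEle
      (fun n => (hgE n).le)
    have h1 : Tendsto (fun n : ℕ => ((n : ℝ≥0∞) + 1)⁻¹) atTop (𝓝 0) := by
      have := (tendsto_add_atTop_iff_nat 1).2 ENNReal.tendsto_inv_nat_nhds_zero
      simpa using this
    simpa using tendsto_const_nhds.add h1
  have hp0 := D.p_pos
  have : Fact (1 ≤ ENNReal.ofReal p) := ⟨by simpa using D.one_le_p⟩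
  let a : ℕ → Lp ℝ (ENNReal.ofReal p) m := fun n => (D.memLp_toReal (hfin n)).toLp _
  -- the minimizing sequence is Cauchy
  have hdist : ∀ i j, edist (a i) (a j) ^ p =
      ∫⁻ x, ‖(g i x).toReal - (g j x).toReal‖ₑ ^ p ∂m := by
    intro i j
    rw [Lp.edist_toLp_toLp, eLpNorm_eq_lintegral_rpow_enorm_toReal (by simp [hp0]) (by simp),
      ENNReal.toReal_ofReal hp0.le, ← ENNReal.rpow_mul, one_div_mul_cancel hp0.ne',
      ENNReal.rpow_one]
    rfl
  have hcauchy : CauchySeq a := by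
    rw [Metric.cauchySeq_iff]
    intro κ hκ
    have hE0 : 0 ≤ E.toReal := ENNReal.toReal_nonneg
    set η := κ ^ p with hη
    have hηpos : 0 < η := Real.rpow_pos_of_pos hκ p
    set ε := η / (4 * (E.toReal + 1)) with hε
    have hεpos : 0 < ε := by positivity
    obtain ⟨C, hC, hconv⟩ := exists_uniform_convexity hp hεpos
    set θ := min 1 (η / (4 * C)) with hθ
    have hθpos : 0 < θ := lt_min one_pos (by positivity)
    have hev : ∀ᶠ n in atTop, ∫⁻ x, g n x ^ p ∂m < E + ENNReal.ofReal θ :=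
      hlim.eventually_lt_const (ENNReal.lt_add_right hE.ne (by simpa using hθpos))
    obtain ⟨N, hN⟩ := eventually_atTop.1 hev
    refine ⟨N, fun i hi j hj => ?_⟩
    have h1 := D.lintegral_sub_rpow_le u hεpos.le hC.le hconv (hg i) (hg j) (hfin i) (hfin j)
    rw [← hdist] at h1
    have h2 : edist (a i) (a j) ^ p + ENNReal.ofReal C * E ≤
        ENNReal.ofReal (ε + C / 2) * ((E + ENNReal.ofReal θ) + (E + ENNReal.ofReal θ)) :=
      h1.trans (by gcongr; exacts [(hN i hi).le, (hN j hj).le])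
    rw [edist_dist, ← ENNReal.ofReal_toReal hE.ne,
      ENNReal.ofReal_rpow_of_nonneg dist_nonneg hp0.le, ← ENNReal.ofReal_mul hC.le,
      ← ENNReal.ofReal_add (by positivity) (by positivity),
      ← ENNReal.ofReal_add (by positivity) (by positivity),
      ← ENNReal.ofReal_add (by positivity) (by positivity),
      ← ENNReal.ofReal_mul (by positivity), ENNReal.ofReal_le_ofReal_iff (by positivity)] at h2
    have h3 : ε * (E.toReal + 1) = η / 4 := by rw [hε]; field_simp
    have h4 : C * θ ≤ η / 4 := by
      calc C * θ ≤ C * (η / (4 * C)) := by gcongr; exact min_le_right _ _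
        _ = η / 4 := by field_simp
    have h5 : ε * θ ≤ ε * 1 := by gcongr; exact min_le_left _ _
    have h6 : dist (a i) (a j) ^ p < κ ^ p := by
      rw [← hη]; linarith
    exact (Real.rpow_lt_rpow_iff dist_nonneg hκ.le hp0).1 h6
  obtain ⟨b, hb⟩ := cauchySeq_tendsto_of_complete hcauchy
  have hmb : AEStronglyMeasurable (fun x => ENNReal.ofReal (b x)) m :=
    (Lp.aestronglyMeasurable b).aemeasurable.ennreal_ofReal.aestronglyMeasurable
  have hbE : ∫⁻ x, ‖b x‖ₑ ^ p ∂m = E := by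
    have e1 : ∀ n, ‖a n‖ₑ = (∫⁻ x, g n x ^ p ∂m) ^ (1 / p) := by
      intro n
      rw [Lp.enorm_toLp, D.eLpNorm_toReal (hfin n)]
    have l1 : Tendsto (fun n => ‖a n‖ₑ) atTop (𝓝 ‖b‖ₑ) := hb.enorm
    have l2 : Tendsto (fun n => ‖a n‖ₑ) atTop (𝓝 (E ^ (1 / p))) := by
      simp only [e1]
      exact (ENNReal.continuous_rpow_const.tendsto E).comp hlim
    have e2 := tendsto_nhds_unique l1 l2
    rw [Lp.enorm_def, eLpNorm_eq_lintegral_rpow_enorm_toReal (by simp [hp0]) (by simp),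
      ENNReal.toReal_ofReal hp0.le] at e2
    exact ENNReal.rpow_left_injective (by positivity) e2
  have hle : ∫⁻ x, AEEqFun.mk _ hmb x ^ p ∂m ≤ E := by
    rw [← hbE]
    refine lintegral_mono_ae ?_
    filter_upwards [AEEqFun.coeFn_mk _ hmb] with x hx
    rw [hx]
    gcongr
    rw [Real.enorm_eq_ofReal_abs]
    exact ENNReal.ofReal_le_ofReal (le_abs_self _)
  have hpg : AEEqFun.mk _ hmb ∈ D.pg u := by
    refine D.completeness (fun _ => u) u g _ hg hfin (hle.trans_lt hE) (fun B _ _ => by simp) ?_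
    have l1 : Tendsto (fun n => edist (a n) b) atTop (𝓝 0) := tendsto_iff_edist_tendsto_0.1 hb
    refine tendsto_of_tendsto_of_tendsto_of_le_of_le tendsto_const_nhds l1 (fun _ => zero_le)
      fun n => ?_
    dsimp only
    rw [Lp.edist_def]
    refine eLpNorm_mono_ae ?_
    filter_upwards [AEEqFun.coeFn_mk _ hmb, (D.memLp_toReal (hfin n)).coeFn_toLp] with x hx hx'
    rw [hx, Pi.sub_apply, hx', ENNReal.toReal_ofReal', Real.norm_eq_abs, Real.norm_eq_abs]
    have h0 : 0 ≤ (g n x).toReal := ENNReal.toReal_nonneg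
    calc |(g n x).toReal - max (b x) 0| = |max (g n x).toReal 0 - max (b x) 0| := by
          rw [max_eq_left h0]
      _ ≤ _ := abs_max_sub_max_le_abs _ _ _
  refine ⟨AEEqFun.mk _ hmb, hpg, le_antisymm hle ?_⟩
  simpa [hEdef, energy] using
    iInf₂_le (f := fun g (_ : g ∈ D.pg u) => ∫⁻ x in univ, g x ^ p ∂m) _ hpg

/-- Minimal pseudo-gradients are unique. -/
theorem IsMinimal.unique {D : DStructure m p} (hp : 1 < p) {u : D.sobolevClass}
    {g k : LZeroPlus m} (hg : D.IsMinimal u g) (hk : D.IsMinimal u k) : g = k := by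
  have hE : D.energy u univ < ∞ := u.2
  have hg' : ∫⁻ x, g x ^ p ∂m < ∞ := by rw [hg.2]; exact hE
  have hk' : ∫⁻ x, k x ^ p ∂m < ∞ := by rw [hk.2]; exact hE
  have hp0 := D.p_pos
  have hz : ∫⁻ x, ‖(g x).toReal - (k x).toReal‖ₑ ^ p ∂m = 0 := by
    refine nonpos_iff_eq_zero.1 (ENNReal.le_of_forall_pos_le_add fun δ hδ _ => ?_)
    set E := D.energy u univ with hEdef
    have hE0 : 0 ≤ E.toReal := ENNReal.toReal_nonneg
    set ε : ℝ := δ / (2 * (E.toReal + 1)) with hε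
    have hεpos : 0 < ε := by positivity
    obtain ⟨C, hC, hconv⟩ := exists_uniform_convexity hp hεpos
    have h1 := D.lintegral_sub_rpow_le u hεpos.le hC.le hconv hg.1 hk.1 hg' hk'
    rw [hg.2, hk.2, ← hEdef] at h1
    have hfin : ENNReal.ofReal C * E ≠ ∞ := ENNReal.mul_ne_top (by simp) hE.ne
    rw [zero_add]
    refine (ENNReal.add_le_add_iff_right hfin).1 (h1.trans ?_)
    rw [← ENNReal.ofReal_toReal hE.ne, ← ENNReal.ofReal_mul hC.le,
      ← ENNReal.ofReal_add (by positivity) (by positivity), ← ENNReal.ofReal_mul (by positivity),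
      ← ENNReal.ofReal_coe_nnreal, ← ENNReal.ofReal_add (by positivity) (by positivity)]
    refine ENNReal.ofReal_le_ofReal ?_
    have h3 : ε * (E.toReal + 1) = δ / 2 := by rw [hε]; field_simp
    linarith
  rw [lintegral_eq_zero_iff (by
    exact (((g.measurable.ennreal_toReal.sub k.measurable.ennreal_toReal).enorm).pow_const p))]
    at hz
  refine AEEqFun.ext ?_
  filter_upwards [hz, D.ae_lt_top_of_rpow hg', D.ae_lt_top_of_rpow hk'] with x hx h1 h2
  have h3 : (g x).toReal - (k x).toReal = 0 := by
    simpa [ENNReal.rpow_eq_zero_iff, hp0, hp0.le, not_lt.2 hp0.le] using hx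
  exact (ENNReal.toReal_eq_toReal_iff' h1.ne h2.ne).1 (sub_eq_zero.1 h3)

theorem isMinimal_minPG (D : DStructure m p) (hp : 1 < p) (u : D.sobolevClass) :
    D.IsMinimal u (D.minPG u) :=
  Classical.epsilon_spec (D.exists_isMinimal hp u)

/-- Pointwise locality: properties L1 and L5. -/
structure IsPointwiseLocal (D : DStructure m p) : Prop where
  /-- L1: if `u ∈ S^p(X)` is a.e. constant on the Borel set `B`, then `E_p(u|B) = 0`. -/
  energy_eq_zero : ∀ (u : D.sobolevClass) (B : Set X), MeasurableSet B →
    (∃ c : ℝ, ∀ᵐ x ∂m.restrict B, ((u : Lploc m p) : X →ₘ[m] ℝ) x = c) →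
    D.energy u B = 0
  /-- L5: `Du ≤ g` a.e. for every `g ∈ D[u]`. -/
  minPG_le : ∀ (u : D.sobolevClass), ∀ g ∈ D.pg u, D.minPG u ≤ g

section Locality

variable {D : DStructure m p}

theorem minPG_add_le (hp : 1 < p) (hD : D.IsPointwiseLocal) (u v : D.sobolevClass) :
    ∀ᵐ x ∂m, D.minPG (u + v) x ≤ D.minPG u x + D.minPG v x := by
  have h := hD.minPG_le (u + v) _
    (D.add_mem_pg (D.isMinimal_minPG hp u).1 (D.isMinimal_minPG hp v).1)
  filter_upwards [AEEqFun.coeFn_le.2 h, AEEqFun.coeFn_add (D.minPG u) (D.minPG v)] with x h1 h2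
  rwa [h2] at h1

theorem minPG_smul_le (hp : 1 < p) (hD : D.IsPointwiseLocal) (c : ℝ) (u : D.sobolevClass) :
    ∀ᵐ x ∂m, D.minPG (c • u) x ≤ ‖c‖ₑ * D.minPG u x := by
  obtain ⟨h, hh, hh'⟩ := D.exists_smul_mem_pg (D.isMinimal_minPG hp u).1 c
  filter_upwards [AEEqFun.coeFn_le.2 (hD.minPG_le (c • u) h hh), hh'] with x h1 h2
  rwa [h2] at h1

theorem minPG_lintegral_lt_top (hp : 1 < p) (u : D.sobolevClass) :
    ∫⁻ x, D.minPG u x ^ p ∂m < ∞ := by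
  rw [(D.isMinimal_minPG hp u).2]; exact u.2

end Locality

/-- The pre-cotangent module: finite families `(Bᵢ, uᵢ)` with `(Bᵢ)` a Borel partition of `X` and
`uᵢ ∈ S^p(X)`, encoded as the simple function equal to `uᵢ` on `Bᵢ`. The pointwise operations of
simple functions are `[Bᵢ, uᵢ] + [Cⱼ, vⱼ] = [Bᵢ ∩ Cⱼ, uᵢ + vⱼ]` and `λ [Bᵢ, uᵢ] = [Bᵢ, λ uᵢ]`. -/
@[nolint unusedArguments]
def PreCotangent (D : DStructure m p) (_hp : 1 < p) (_hD : D.IsPointwiseLocal) :=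
  SimpleFunc X D.sobolevClass

section Cotangent

variable {D : DStructure m p} {hp : 1 < p} {hD : D.IsPointwiseLocal}

instance : AddCommGroup (PreCotangent D hp hD) :=
  inferInstanceAs (AddCommGroup (SimpleFunc X D.sobolevClass))

instance : Module ℝ (PreCotangent D hp hD) :=
  inferInstanceAs (Module ℝ (SimpleFunc X D.sobolevClass))

namespace PreCotangent

/-- The simple function `X → S^p(X)` underlying an element of the pre-cotangent module. -/
def toSimpleFunc (F : PreCotangent D hp hD) : SimpleFunc X D.sobolevClass := F

/-- The pointwise norm `|[Bᵢ, uᵢ]| = ∑ᵢ χ_{Bᵢ} Duᵢ`. -/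
def pointwiseNorm (F : PreCotangent D hp hD) (x : X) : ℝ≥0∞ := D.minPG (F.toSimpleFunc x) x

theorem measurable_pointwiseNorm (F : PreCotangent D hp hD) : Measurable F.pointwiseNorm :=
  SimpleFunc.measurable_bind F.toSimpleFunc (fun u x => D.minPG u x)
    fun u => (D.minPG u).measurable

theorem ae_simpleFunc {P : D.sobolevClass → X → Prop} (F : PreCotangent D hp hD)
    (h : ∀ u, ∀ᵐ x ∂m, P u x) : ∀ᵐ x ∂m, P (F.toSimpleFunc x) x := by
  have : ∀ᵐ x ∂m, ∀ u ∈ F.toSimpleFunc.range, P u x :=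
    (Finset.eventually_all _).2 fun u _ => h u
  filter_upwards [this] with x hx
  exact hx _ (SimpleFunc.mem_range_self _ x)

theorem pointwiseNorm_add_le (F G : PreCotangent D hp hD) :
    ∀ᵐ x ∂m, (F + G).pointwiseNorm x ≤ F.pointwiseNorm x + G.pointwiseNorm x := by
  have : ∀ᵐ x ∂m, ∀ v ∈ G.toSimpleFunc.range,
      D.minPG (F.toSimpleFunc x + v) x ≤ D.minPG (F.toSimpleFunc x) x + D.minPG v x :=
    (Finset.eventually_all _).2 fun v _ => F.ae_simpleFunc fun u => minPG_add_le hp hD u v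
  filter_upwards [this] with x hx
  exact hx _ (SimpleFunc.mem_range_self _ x)

theorem pointwiseNorm_smul_le (c : ℝ) (F : PreCotangent D hp hD) :
    ∀ᵐ x ∂m, (c • F).pointwiseNorm x ≤ ‖c‖ₑ * F.pointwiseNorm x :=
  F.ae_simpleFunc fun u => minPG_smul_le hp hD c u

/-- `‖[Bᵢ, uᵢ]‖ = ‖|[Bᵢ, uᵢ]|‖_{L^p(m)} = (∑ᵢ ∫_{Bᵢ} (Duᵢ)^p dm)^{1/p}`, as an extended number. -/
def eNorm (F : PreCotangent D hp hD) : ℝ≥0∞ := (∫⁻ x, F.pointwiseNorm x ^ p ∂m) ^ (1 / p)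

theorem eNorm_lt_top (F : PreCotangent D hp hD) : F.eNorm < ∞ := by
  refine ENNReal.rpow_lt_top_of_nonneg (by have := D.p_pos; positivity) (ne_of_lt ?_)
  calc ∫⁻ x, F.pointwiseNorm x ^ p ∂m
      ≤ ∫⁻ x, ∑ u ∈ F.toSimpleFunc.range, D.minPG u x ^ p ∂m := by
        refine lintegral_mono fun x => ?_
        exact Finset.single_le_sum (f := fun u => D.minPG u x ^ p) (fun _ _ => zero_le)
          (SimpleFunc.mem_range_self _ x)
    _ = ∑ u ∈ F.toSimpleFunc.range, ∫⁻ x, D.minPG u x ^ p ∂m :=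
        lintegral_finsetSum _ fun u _ => (D.minPG u).measurable.pow_const p
    _ < ∞ := ENNReal.sum_lt_top.2 fun u _ => minPG_lintegral_lt_top hp u

theorem eNorm_add_le (F G : PreCotangent D hp hD) : (F + G).eNorm ≤ F.eNorm + G.eNorm := by
  have hp0 := D.p_pos
  refine le_trans ?_ (ENNReal.lintegral_Lp_add_le F.measurable_pointwiseNorm.aemeasurable
    G.measurable_pointwiseNorm.aemeasurable D.one_le_p)
  refine ENNReal.rpow_le_rpow (lintegral_mono_ae ?_) (by positivity)
  filter_upwards [pointwiseNorm_add_le F G] with x hx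
  exact ENNReal.rpow_le_rpow hx hp0.le

theorem eNorm_smul_le (c : ℝ) (F : PreCotangent D hp hD) : (c • F).eNorm ≤ ‖c‖ₑ * F.eNorm := by
  have hp0 := D.p_pos
  have hc : ‖c‖ₑ ^ p ≠ ∞ := ENNReal.rpow_ne_top_of_nonneg hp0.le (by simp)
  calc (c • F).eNorm ≤ (∫⁻ x, ‖c‖ₑ ^ p * F.pointwiseNorm x ^ p ∂m) ^ (1 / p) := by
        refine ENNReal.rpow_le_rpow (lintegral_mono_ae ?_) (by positivity)
        filter_upwards [pointwiseNorm_smul_le c F] with x hx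
        rw [← ENNReal.mul_rpow_of_nonneg _ _ hp0.le]
        exact ENNReal.rpow_le_rpow hx hp0.le
    _ = ‖c‖ₑ * F.eNorm := by
        rw [lintegral_const_mul' _ _ hc, ENNReal.mul_rpow_of_nonneg _ _ (by positivity),
          ← ENNReal.rpow_mul, mul_one_div_cancel hp0.ne', ENNReal.rpow_one, eNorm]

theorem toReal_eNorm_smul_le (c : ℝ) (F : PreCotangent D hp hD) :
    (c • F).eNorm.toReal ≤ ‖c‖ * F.eNorm.toReal := by
  have := ENNReal.toReal_mono (ENNReal.mul_ne_top (by simp) F.eNorm_lt_top.ne) (eNorm_smul_le c F)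
  simpa [ENNReal.toReal_mul] using this

end PreCotangent

/-- The seminorm `F ↦ ‖F‖` makes the pre-cotangent module a seminormed space. -/
instance : SeminormedAddCommGroup (PreCotangent D hp hD) :=
  AddGroupSeminorm.toSeminormedAddCommGroup
    { toFun := fun F => F.eNorm.toReal
      map_zero' := by
        have := PreCotangent.toReal_eNorm_smul_le 0 (0 : PreCotangent D hp hD)
        rw [zero_smul, norm_zero, zero_mul] at this
        exact le_antisymm this ENNReal.toReal_nonneg
      add_le' := fun F G => by
        rw [← ENNReal.toReal_add F.eNorm_lt_top.ne G.eNorm_lt_top.ne]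
        exact ENNReal.toReal_mono
          (ENNReal.add_ne_top.2 ⟨F.eNorm_lt_top.ne, G.eNorm_lt_top.ne⟩)
          (PreCotangent.eNorm_add_le F G)
      neg' := fun F => by
        have h : ∀ G : PreCotangent D hp hD, (-G).eNorm.toReal ≤ G.eNorm.toReal := fun G => by
          simpa using PreCotangent.toReal_eNorm_smul_le (-1) G
        exact le_antisymm (h F) (by simpa using h (-F)) }

instance : NormedSpace ℝ (PreCotangent D hp hD) where
  norm_smul_le c F := PreCotangent.toReal_eNorm_smul_le c F

end Cotangent

/-- The cotangent module `L^p(T*X; D)`, as a Banach space: the (Hausdorff) completion of the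
pre-cotangent module. The completion identifies elements at distance zero, i.e. `[Bᵢ, uᵢ]` and
`[Cⱼ, vⱼ]` whenever `D(uᵢ - vⱼ) = 0` a.e. on `Bᵢ ∩ Cⱼ` for all `i, j`. -/
abbrev Cotangent (D : DStructure m p) (hp : 1 < p) (hD : D.IsPointwiseLocal) :=
  UniformSpace.Completion (PreCotangent D hp hD)

/-- The differential `d : S^p(X) → L^p(T*X; D)`, `du = [X, u]`. -/
def differential (D : DStructure m p) (hp : 1 < p) (hD : D.IsPointwiseLocal) :
    D.sobolevClass →ₗ[ℝ] Cotangent D hp hD :=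
  (UniformSpace.Completion.toComplₗᵢ (𝕜 := ℝ) (E := PreCotangent D hp hD)).toLinearMap ∘ₗ
    { toFun := fun u => (SimpleFunc.const X u : SimpleFunc X D.sobolevClass)
      map_add' := fun _ _ => rfl
      map_smul' := fun _ _ => rfl }

end DStructure

end

/-! ### Weak limits and convex combinations -/

open MeasureTheory Filter Topology Set
open scoped ENNReal NNReal

/-! Mazur's lemma reduces weak to strong convergence. By `mem_closure_convexHull_tail`, `ω` is a
norm limit of convex combinations of the tails of the differentials. Since the differential is
linear, these are differentials of convex combinations `w n` of the tails of `u`. Because tails are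
used, `w n` still converges to `v` in `L^p_loc` (`tendstoLploc_of_mem_convexHull_tail`).

For strong convergence, the inequality `|Du - Dv| ≤ D(u - v)` (`norm_minPGLp_sub_le`) shows that
Cauchy differentials have Cauchy minimal pseudo-gradients in `L^p(m)`. By A5 the positive part of
their limit is a pseudo-gradient of `v`. So `v` is Sobolev, and the norm of its differential is at
most any eventual bound on the norms along the sequence (`exists_mem_sobolevClass_of_cauchySeq`).

This semicontinuity, applied to `u n - u k → u n - v` as `k → ∞`, bounds the distance from `d(u n)`
to `dv` by the Cauchy modulus of the differentials. Hence `d(u n) → dv`, and uniqueness of limits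
gives `dv = ω` (`differential_eq_of_tendsto`). -/

/-- A weak sequential limit is a limit in norm of convex combinations of the tails. -/
theorem mem_closure_convexHull_tail {E : Type*} [NormedAddCommGroup E] [NormedSpace ℝ E]
    {x : ℕ → E} {a : E} (h : ∀ φ : StrongDual ℝ E, Tendsto (fun n => φ (x n)) atTop (𝓝 (φ a)))
    (N : ℕ) : a ∈ closure (convexHull ℝ (x '' Ici N)) := by
  by_contra ha
  -- A functional `f` below `c` on the closed hull and above `c` at `a` contradicts weak convergence
  -- tested on `f`.
  obtain ⟨f, c, hc, hca⟩ := geometric_hahn_banach_closed_point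
    (convex_convexHull ℝ (x '' Ici N)).closure isClosed_closure ha
  have hle : f a ≤ c := le_of_tendsto (h f) <| (eventually_ge_atTop N).mono fun n hn =>
    (hc _ (subset_closure (subset_convexHull ℝ _ (mem_image_of_mem x hn)))).le
  exact hle.not_gt hca

/-! ### Convex combinations and differences in `L^p_loc` -/

namespace DStructure

variable {X : Type*} [MetricSpace X] [MeasurableSpace X] {m : Measure X} {p : ℝ}

/-- Balls of an extended seminorm are convex, by Minkowski's inequality for `p ≥ 1`; the value `∞`
causes no trouble. Convexity lets a bound on a tail pass to its convex hull. -/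
theorem convex_eLpNorm_sub_le (D : DStructure m p) (v : Lploc m p) {B : Set X}
    (ε : ℝ≥0∞) :
    Convex ℝ {w : D.sobolevClass | eLpNorm (fun x => ((w : Lploc m p) : X →ₘ[m] ℝ) x -
      (v : X →ₘ[m] ℝ) x) (ENNReal.ofReal p) (m.restrict B) ≤ ε} := by
  intro w₁ h₁ w₂ h₂ s t hs ht hst
  rw [mem_ofPred_eq] at h₁ h₂ ⊢
  set f₁ : X → ℝ := fun x => ((w₁ : Lploc m p) : X →ₘ[m] ℝ) x - (v : X →ₘ[m] ℝ) x with hf₁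
  set f₂ : X → ℝ := fun x => ((w₂ : Lploc m p) : X →ₘ[m] ℝ) x - (v : X →ₘ[m] ℝ) x with hf₂
  have hm₁ : AEStronglyMeasurable f₁ (m.restrict B) :=
    ((AEEqFun.aestronglyMeasurable _).sub (AEEqFun.aestronglyMeasurable _)).restrict
  have hm₂ : AEStronglyMeasurable f₂ (m.restrict B) :=
    ((AEEqFun.aestronglyMeasurable _).sub (AEEqFun.aestronglyMeasurable _)).restrict
  have heq : (fun x => (((s • w₁ + t • w₂ : D.sobolevClass) : Lploc m p) : X →ₘ[m] ℝ) x -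
      (v : X →ₘ[m] ℝ) x) =ᵐ[m.restrict B] s • f₁ + t • f₂ := by
    refine ae_restrict_of_ae ?_
    filter_upwards [AEEqFun.coeFn_add (s • ((w₁ : Lploc m p) : X →ₘ[m] ℝ))
        (t • ((w₂ : Lploc m p) : X →ₘ[m] ℝ)),
      AEEqFun.coeFn_smul s ((w₁ : Lploc m p) : X →ₘ[m] ℝ),
      AEEqFun.coeFn_smul t ((w₂ : Lploc m p) : X →ₘ[m] ℝ)] with x h h' h''
    simp only [Submodule.coe_add, Submodule.coe_smul, h, Pi.add_apply, h', h'', Pi.smul_apply,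
      smul_eq_mul, hf₁, hf₂]
    -- The centre `v` appears on the right with total weight `s + t = 1`.
    linear_combination (-(v : X →ₘ[m] ℝ) x) * hst.symm
  calc _ = eLpNorm (s • f₁ + t • f₂) (ENNReal.ofReal p) (m.restrict B) := eLpNorm_congr_ae heq
    _ ≤ eLpNorm (s • f₁) (ENNReal.ofReal p) (m.restrict B) +
        eLpNorm (t • f₂) (ENNReal.ofReal p) (m.restrict B) :=
      eLpNorm_add_le (hm₁.const_smul s) (hm₂.const_smul t) (by simpa using D.one_le_p)
    _ ≤ ‖s‖ₑ * ε + ‖t‖ₑ * ε := by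
      rw [eLpNorm_const_smul, eLpNorm_const_smul]
      gcongr
    _ = ε := by
      rw [← add_mul, Real.enorm_of_nonneg hs, Real.enorm_of_nonneg ht,
        ← ENNReal.ofReal_add hs ht, hst, ENNReal.ofReal_one, one_mul]

/-- Convex combinations of the tails of a sequence converging in `L^p_loc` converge to the same
limit. -/
theorem tendstoLploc_of_mem_convexHull_tail (D : DStructure m p) {u w : ℕ → D.sobolevClass}
    {v : Lploc m p} (hu : TendstoLploc (fun n => (u n : Lploc m p)) v)
    (hw : ∀ n, w n ∈ convexHull ℝ (u '' Ici n)) :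
    TendstoLploc (fun n => (w n : Lploc m p)) v := by
  intro B hB hb
  refine ENNReal.tendsto_nhds_zero.2 fun ε hε => ?_
  obtain ⟨N, hN⟩ := eventually_atTop.1 (ENNReal.tendsto_nhds_zero.1 (hu B hB hb) ε hε)
  refine (eventually_ge_atTop N).mono fun n hn => ?_
  -- The `ε`-ball around `v` is convex and contains every `u k` with `k ≥ n ≥ N`, hence their hull.
  refine convexHull_min ?_ (D.convex_eLpNorm_sub_le v (B := B) ε) (hw n)
  rintro _ ⟨k, hk, rfl⟩
  exact hN k (le_trans hn hk)

theorem TendstoLploc.const_sub {u : ℕ → Lploc m p} {v : Lploc m p}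
    (hu : TendstoLploc u v) (w : Lploc m p) : TendstoLploc (fun n => w - u n) (w - v) := by
  intro B hB hb
  refine (hu B hB hb).congr fun n => ?_
  rw [← eLpNorm_neg]
  refine eLpNorm_congr_ae (ae_restrict_of_ae ?_)
  filter_upwards [AEEqFun.coeFn_sub (w : X →ₘ[m] ℝ) (u n : X →ₘ[m] ℝ),
    AEEqFun.coeFn_sub (w : X →ₘ[m] ℝ) (v : X →ₘ[m] ℝ)] with x h h'
  simp [h, h']

/-! ### Minimal pseudo-gradients in `L^p(m)` and the norm of the differential -/

/-- The minimal pseudo-gradient as an element of `L^p(m)`. -/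
noncomputable def minPGLp (D : DStructure m p) (hp : 1 < p) (u : D.sobolevClass) : Lp ℝ (ENNReal.ofReal p) m :=
  (D.memLp_toReal (minPG_lintegral_lt_top hp u)).toLp _

variable {D : DStructure m p} (hp : 1 < p) (hD : D.IsPointwiseLocal)

theorem coeFn_minPGLp (u : D.sobolevClass) :
    D.minPGLp hp u =ᵐ[m] fun x => (D.minPG u x).toReal :=
  (D.memLp_toReal (minPG_lintegral_lt_top hp u)).coeFn_toLp

theorem differential_sub (u v : D.sobolevClass) :
    D.differential hp hD (u - v) = D.differential hp hD u - D.differential hp hD v :=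
  map_sub (D.differential hp hD) u v

/-- The embedding into the completion is isometric, and `[X, u]` has the single piece `X`. Norm
estimates on differentials thereby become pointwise estimates on minimal pseudo-gradients. -/
theorem norm_differential (u : D.sobolevClass) :
    ‖D.differential hp hD u‖ = ‖D.minPGLp hp u‖ := by
  have h : ‖D.differential hp hD u‖ = ((∫⁻ x, D.minPG u x ^ p ∂m) ^ (1 / p)).toReal :=
    UniformSpace.Completion.norm_coe (E := PreCotangent D hp hD)
      (SimpleFunc.const X u : SimpleFunc X D.sobolevClass)
  rw [h, minPGLp, Lp.norm_toLp, D.eLpNorm_toReal (minPG_lintegral_lt_top hp u)]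

/-- Subadditivity applied to `u = (u - v) + v`; a.e. finiteness allows the passage to real values.
-/
theorem ae_minPG_toReal_le (hp : 1 < p) (hD : D.IsPointwiseLocal) (u v : D.sobolevClass) :
    ∀ᵐ x ∂m, (D.minPG u x).toReal ≤ (D.minPG (u - v) x).toReal + (D.minPG v x).toReal := by
  filter_upwards [minPG_add_le hp hD (u - v) v,
    D.ae_lt_top_of_rpow (minPG_lintegral_lt_top hp (u - v)),
    D.ae_lt_top_of_rpow (minPG_lintegral_lt_top hp v)] with x h h₁ h₂
  rw [show u - v + v = u from sub_add_cancel u v] at h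
  rw [← ENNReal.toReal_add h₁.ne h₂.ne]
  exact ENNReal.toReal_mono (ENNReal.add_ne_top.2 ⟨h₁.ne, h₂.ne⟩) h

/-- Homogeneity with the scalar `-1`. It turns the two one-sided bounds on `Du - Dv` into a bound on
its absolute value. -/
theorem ae_minPG_sub_comm_le (hp : 1 < p) (hD : D.IsPointwiseLocal) (u v : D.sobolevClass) :
    ∀ᵐ x ∂m, D.minPG (v - u) x ≤ D.minPG (u - v) x := by
  filter_upwards [minPG_smul_le hp hD (-1) (u - v)] with x h
  rw [show (-1 : ℝ) • (u - v) = v - u from (neg_one_smul ℝ (u - v)).trans (neg_sub u v)] at h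
  simpa using h

/-- `|Du - Dv| ≤ D(u - v)`, in norm. -/
theorem norm_minPGLp_sub_le (u v : D.sobolevClass) :
    ‖D.minPGLp hp u - D.minPGLp hp v‖ ≤ ‖D.differential hp hD u - D.differential hp hD v‖ := by
  rw [← differential_sub, norm_differential]
  refine Lp.norm_le_norm_of_ae_le ?_
  filter_upwards [Lp.coeFn_sub (D.minPGLp hp u) (D.minPGLp hp v), coeFn_minPGLp hp u,
    coeFn_minPGLp hp v, coeFn_minPGLp hp (u - v), ae_minPG_toReal_le hp hD u v,
    ae_minPG_toReal_le hp hD v u, ae_minPG_sub_comm_le hp hD u v,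
    D.ae_lt_top_of_rpow (minPG_lintegral_lt_top hp (u - v))] with x h h₁ h₂ h₃ h₄ h₅ h₆ h₇
  have h₈ := ENNReal.toReal_mono h₇.ne h₆
  rw [h, Pi.sub_apply, h₁, h₂, h₃, Real.norm_eq_abs, Real.norm_of_nonneg ENNReal.toReal_nonneg,
    abs_le]
  constructor <;> linarith

/-! ### Closedness under norm convergence -/

/-- If `uₙ → v` in `L^p_loc` and the differentials of `uₙ` form a Cauchy sequence, then `v` is a
Sobolev function whose differential is controlled by those of `uₙ`. -/
theorem exists_mem_sobolevClass_of_cauchySeq {u : ℕ → D.sobolevClass} {v : Lploc m p}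
    (hu : TendstoLploc (fun n => (u n : Lploc m p)) v)
    (hc : CauchySeq fun n => D.differential hp hD (u n)) :
    ∃ hv : v ∈ D.sobolevClass, ∀ c : ℝ, (∀ᶠ n in atTop, ‖D.differential hp hD (u n)‖ ≤ c) →
      ‖D.differential hp hD ⟨v, hv⟩‖ ≤ c := by
  have hp0 := D.p_pos
  have : Fact (1 ≤ ENNReal.ofReal p) := ⟨by simpa using D.one_le_p⟩
  have hc' : CauchySeq fun n => D.minPGLp hp (u n) := by
    rw [Metric.cauchySeq_iff] at hc ⊢
    intro ε hε
    obtain ⟨N, hN⟩ := hc ε hε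
    refine ⟨N, fun i hi j hj => lt_of_le_of_lt ?_ (hN i hi j hj)⟩
    rw [dist_eq_norm, dist_eq_norm]
    exact norm_minPGLp_sub_le hp hD _ _
  obtain ⟨b, hb⟩ := cauchySeq_tendsto_of_complete hc'
  -- The candidate pseudo-gradient is the positive part of `b`, so nonnegativity of `b` need not be
  -- shown. Truncation at `0` is 1-Lipschitz and fixes the nonnegative approximants, so convergence
  -- survives.
  have hmb : AEStronglyMeasurable (fun x => ENNReal.ofReal (b x)) m :=
    (Lp.aestronglyMeasurable b).aemeasurable.ennreal_ofReal.aestronglyMeasurable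
  have hmk := AEEqFun.coeFn_mk _ hmb
  have hfin : ∫⁻ x, AEEqFun.mk _ hmb x ^ p ∂m < ∞ := by
    have h := lintegral_rpow_enorm_lt_top_of_eLpNorm_lt_top (by simp [hp0]) (by simp)
      (Lp.eLpNorm_lt_top b)
    rw [ENNReal.toReal_ofReal hp0.le] at h
    refine lt_of_le_of_lt (lintegral_mono_ae ?_) h
    filter_upwards [hmk] with x hx
    rw [hx]
    gcongr
    rw [Real.enorm_eq_ofReal_abs]
    exact ENNReal.ofReal_le_ofReal (le_abs_self _)
  have hpg : AEEqFun.mk _ hmb ∈ D.pg v := by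
    refine D.completeness (fun n => u n) v (fun n => D.minPG (u n)) _
      (fun n => (D.isMinimal_minPG hp (u n)).1) (fun n => minPG_lintegral_lt_top hp (u n))
      hfin hu ?_
    refine tendsto_of_tendsto_of_tendsto_of_le_of_le tendsto_const_nhds
      (tendsto_iff_edist_tendsto_0.1 hb) (fun _ => zero_le) fun n => ?_
    dsimp only
    rw [Lp.edist_def]
    refine eLpNorm_mono_ae ?_
    filter_upwards [hmk, coeFn_minPGLp hp (u n)] with x hx hx'
    rw [hx, Pi.sub_apply, hx', ENNReal.toReal_ofReal', Real.norm_eq_abs, Real.norm_eq_abs]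
    have h0 : 0 ≤ (D.minPG (u n) x).toReal := ENNReal.toReal_nonneg
    calc |(D.minPG (u n) x).toReal - max (b x) 0|
        = |max (D.minPG (u n) x).toReal 0 - max (b x) 0| := by rw [max_eq_left h0]
      _ ≤ _ := abs_max_sub_max_le_abs _ _ _
  have hv : v ∈ D.sobolevClass := (D.energy_lt_top_iff v).2 ⟨_, hpg, hfin⟩
  refine ⟨hv, fun c hcle => ?_⟩
  -- By L5 the minimal pseudo-gradient of `v` lies below the positive part of `b`.
  have hle : ‖D.differential hp hD ⟨v, hv⟩‖ ≤ ‖b‖ := by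
    rw [norm_differential]
    refine Lp.norm_le_norm_of_ae_le ?_
    filter_upwards [coeFn_minPGLp hp ⟨v, hv⟩, hmk,
      AEEqFun.coeFn_le.2 (hD.minPG_le ⟨v, hv⟩ _ hpg)] with x h₁ h₂ h₃
    rw [h₂] at h₃
    rw [h₁, Real.norm_of_nonneg ENNReal.toReal_nonneg]
    refine (ENNReal.toReal_mono ENNReal.ofReal_ne_top h₃).trans ?_
    rw [ENNReal.toReal_ofReal']
    exact max_le (Real.le_norm_self _) (norm_nonneg _)
  refine hle.trans (le_of_tendsto hb.norm ?_)
  filter_upwards [hcle] with n hn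
  rwa [← norm_differential hp hD]

/-- The differential is closed with respect to norm convergence of the differentials. -/
theorem differential_eq_of_tendsto {u : ℕ → D.sobolevClass} {v : Lploc m p}
    (hu : TendstoLploc (fun n => (u n : Lploc m p)) v) {ω : Cotangent D hp hD}
    (hω : Tendsto (fun n => D.differential hp hD (u n)) atTop (𝓝 ω)) :
    ∃ hv : v ∈ D.sobolevClass, D.differential hp hD ⟨v, hv⟩ = ω := by
  -- Only membership is needed here; the norm bound is used below, for differences.
  obtain ⟨hv, -⟩ := exists_mem_sobolevClass_of_cauchySeq hp hD hu hω.cauchySeq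
  refine ⟨hv, tendsto_nhds_unique ?_ hω⟩
  rw [Metric.tendsto_atTop]
  intro ε hε
  obtain ⟨N, hN⟩ := Metric.cauchySeq_iff.1 hω.cauchySeq (ε / 2) (half_pos hε)
  refine ⟨N, fun n hn => ?_⟩
  -- Here `n` is fixed and `k → ∞`.
  have hsub : TendstoLploc (fun k => ((u n - u k : D.sobolevClass) : Lploc m p))
      ((u n : Lploc m p) - v) := TendstoLploc.const_sub hu (u n)
  have hcauchy : CauchySeq fun k => D.differential hp hD (u n - u k) := by
    have h := (tendsto_const_nhds (x := D.differential hp hD (u n))).sub hω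
    exact (h.congr fun k => (differential_sub hp hD (u n) (u k)).symm).cauchySeq
  obtain ⟨hv', hle⟩ := exists_mem_sobolevClass_of_cauchySeq hp hD hsub hcauchy
  -- The limit preserves only `≤`; the margin `ε / 2` restores the strict inequality.
  have h := hle (ε / 2) ((eventually_ge_atTop N).mono fun k hk => by
    rw [differential_sub, ← dist_eq_norm]
    exact (hN n hn k hk).le)
  rw [dist_eq_norm, ← differential_sub]
  exact lt_of_le_of_lt h (half_lt_self hε)

end DStructure

/-! ### From weak to norm convergence -/

theorem theorem3p3 {X : Type*} [MetricSpace X] [CompleteSpace X] [TopologicalSpace.SeparableSpace X]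
    [MeasurableSpace X] [BorelSpace X] (m : Measure X) (hm : m ≠ 0)
    (hball : ∀ (x : X) (r : ℝ), m (Metric.ball x r) < ∞)
    (p : ℝ) (hp : 1 < p) (D : DStructure m p) (hD : D.IsPointwiseLocal)
    (u : ℕ → D.sobolevClass) (v : Lploc m p)
    (hu : TendstoLploc (fun n => (u n : Lploc m p)) v)
    (ω : DStructure.Cotangent D hp hD)
    (hω : ∀ φ : StrongDual ℝ (DStructure.Cotangent D hp hD),
      Tendsto (fun n => φ (D.differential hp hD (u n))) atTop (𝓝 (φ ω))) :
    ∃ hv : v ∈ D.sobolevClass, D.differential hp hD ⟨v, hv⟩ = ω := by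
  have key : ∀ N : ℕ, ∃ w ∈ convexHull ℝ (u '' Ici N),
      dist ω (D.differential hp hD w) < 1 / ((N : ℝ) + 1) := by
    intro N
    have h := mem_closure_convexHull_tail hω N
    -- Linearity realizes each convex combination of differentials as the differential of one
    -- Sobolev function.
    have himage : convexHull ℝ ((fun n => D.differential hp hD (u n)) '' Ici N) =
        D.differential hp hD '' convexHull ℝ (u '' Ici N) := by
      rw [(D.differential hp hD).image_convexHull (u '' Ici N), image_image]
    rw [himage] at h
    obtain ⟨_, ⟨w, hw, rfl⟩, hd⟩ := Metric.mem_closure_iff.1 h (1 / ((N : ℝ) + 1)) (by positivity)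
    exact ⟨w, hw, hd⟩
  choose w hw hd using key
  refine DStructure.differential_eq_of_tendsto hp hD
    (D.tendstoLploc_of_mem_convexHull_tail hu hw) (tendsto_iff_dist_tendsto_zero.2 ?_)
  refine squeeze_zero (fun _ => dist_nonneg) (fun n => ?_) tendsto_one_div_add_atTop_nhds_zero_nat
  rw [dist_comm]
  exact (hd n).le
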